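/- Let $\mathbb F_q$ be a finite field with $q$ elements and let $\mathbb N=\{1,2,\dots\}$. Let $\Gamma=\{x_{n,\varepsilon} : n\in\mathbb N,\ \varepsilon\in\mathbb F_q^{\times}\}$, let $\langle\Gamma\rangle$ be the set of words over $\Gamma$ (with empty word $1$), and let $\mathfrak D$ be the $\mathbb F_q$-vector space with basis $\langle\Gamma\rangle$; for a letter $x$ and $\mathfrak w\in\mathfrak D$, $x\mathfrak w$ denotes concatenation, extended linearly. The weight of a word is the sum of the first indices $n$ of its letters, its depth is the number of its letters. We write $x_n:=x_{n,1}$, and $\langle\Sigma\rangle\subset\langle\Gamma\rangle$ for the set of words in the letters $x_n$, $n\in\mathbb N$. For positive integers $r,s,i$ with $i<r+s$ put $$\Delta^i_{r,s}=(-1)^{r-1}\binom{i-1}{r-1}+(-1)^{s-1}\binom{i-1}{s-1}\in\mathbb F_q\ \text{ if } (q-1)\mid i,\qquad \Delta^i_{r,s}=0\ \text{ otherwise.}$$ The $\mathbb F_q$-bilinear products $\diamond$ and $\mathbin{\sqcup\!\sqcup}$ on $\mathfrak D$ are defined recursively by $1\diamond\mathfrak a=\mathfrak a\diamond1=\mathfrak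 a$, $1\mathbin{\sqcup\!\sqcup}\mathfrak a=\mathfrak a\mathbin{\sqcup\!\sqcup}1=\mathfrak a$ and, for nonempty words $\mathfrak a=x_{a,\alpha}\mathfrak a_-$ and $\mathfrak b=x_{b,\beta}\mathfrak b_-$, $$\mathfrak a\diamond\mathfrak b=x_{a+b,\alpha\beta}(\mathfrak a_-\mathbin{\sqcup\!\sqcup}\mathfrak b_-)+\sum_{i+j=a+b,\ i,j\ge1}\Delta^j_{a,b}\,x_{i,\alpha\beta}\bigl(x_{j,1}\mathbin{\sqcup\!\sqcup}(\mathfrak a_-\mathbin{\sqcup\!\sqcup}\mathfrak b_-)\bigr),$$ $$\mathfrak a\mathbin{\sqcup\!\sqcup}\mathfrak b=x_{a,\alpha}(\mathfrak a_-\mathbin{\sqcup\!\sqcup}\mathfrak b)+x_{b,\beta}(\mathfrak a\mathbin{\sqcup\!\sqcup}\mathfrak b_-)+\mathfrak a\diamond\mathfrak b.$$ For a word $\mathfrak a=x_{i_1}\cdots x_{i_m}\in\langle\Sigma\rangle$ of weight $w$ put $[\mathfrak a]=(-1)^m\Delta^{i_1}_{1,w+1}\cdots\Delta^{i_m}_{1,w+1}\;x_{i_1}\mathbin{\sqcup\!\sqcup}(x_{i_2}\mathbin{\sqcup\!\sqcup}(\cdots\mathbin{\sqcup\!\sqcup}x_{i_m}))$,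 with $[1]=1$. The linear map $\Delta:\mathfrak D\to\mathfrak D\otimes\mathfrak D$ (tensor product over $\mathbb F_q$) is defined on words by $\Delta(1)=1\otimes1$, in depth one by $$\Delta(x_{n,\varepsilon})=1\otimes x_{n,\varepsilon}+\sum_{\substack{r\in\mathbb N,\ \mathfrak a\in\langle\Sigma\rangle\\ r+\mathrm{weight}(\mathfrak a)=n}}\binom{r+\mathrm{depth}(\mathfrak a)-2}{\mathrm{depth}(\mathfrak a)}\,x_{r,\varepsilon}\otimes[\mathfrak a],$$ where $\binom ab=\frac{a(a-1)\cdots(a-b+1)}{b!}$ for $a\in\mathbb Z$ and $b\ge0$ (so $\binom{-1}{0}=1$), and, recursively on the depth, for a letter $x$ and a nonempty word $\mathfrak v$, by $$\Delta(x\mathfrak v)=1\otimes x\mathfrak v+\sum(a_x a_{\mathfrak v})\otimes(b_x\mathbin{\sqcup\!\sqcup}b_{\mathfrak v}),\qquad\text{where }\ \Delta(x)=1\otimes x+\sum a_x\otimes b_x\ \text{ is the depth-one formula and }\ \Delta(\mathfrak v)=\sum a_{\mathfrak v}\otimes b_{\mathfrak v}.$$ Theorem. The coproduct $\Delta$ is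 coassociative: for every word $\mathfrak u\in\langle\Gamma\rangle$, $$(\mathrm{Id}\otimes\Delta)\Delta(\mathfrak u)=(\Delta\otimes\mathrm{Id})\Delta(\mathfrak u)\quad\text{in }\mathfrak D\otimes\mathfrak D\otimes\mathfrak D.$$ -/

import Mathlib

open scoped TensorProduct

noncomputable section

namespace AMZV

/-- The alphabet `Γ = {x_{n,ε}}`: the letter `x_{n,ε}` is the pair `(n, ε)`, with `n` a positive
integer and `ε` a nonzero element of `F`. -/
abbrev Letter (F : Type*) [Field F] : Type _ := ℕ+ × Fˣ

/-- Words over `Γ`; the empty word is `[]`, and the depth of a word is its length. -/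
abbrev Word (F : Type*) [Field F] : Type _ := List (Letter F)

/-- The space `𝔇`: the free `F`-vector space with basis the words over `Γ`. -/
abbrev WordSpace (F : Type*) [Field F] : Type _ := Word F →₀ F

/-- A word, seen as a basis vector of `𝔇`. -/
def ofWord {F : Type*} [Field F] (u : Word F) : WordSpace F := Finsupp.single u 1

/-- Left concatenation `𝔞 ↦ x 𝔞` with a letter `x`, extended linearly. -/
def prepend {F : Type*} [Field F] (x : Letter F) : WordSpace F →ₗ[F] WordSpace F :=
  Finsupp.lmapDomain F F (List.cons x)

@[simp] theorem prepend_ofWord {F : Type*} [Field F] (x : Letter F) (u : Word F) :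
    prepend x (ofWord u) = ofWord (x :: u) := by
  simp [prepend, ofWord]

/-- The coefficient `Δ^i_{r,s}`, where `q` is the cardinality of `F`. -/
def delta (F : Type*) [Field F] (i r s : ℕ+) : F :=
  if (Nat.card F - 1) ∣ (i : ℕ) then
    (-1) ^ ((r : ℕ) - 1) * (((i : ℕ) - 1).choose ((r : ℕ) - 1) : F)
      + (-1) ^ ((s : ℕ) - 1) * (((i : ℕ) - 1).choose ((s : ℕ) - 1) : F)
  else 0

/-- The pairs `(i, j)` of positive integers with `i + j = n`. -/
def pairs (n : ℕ+) : Finset (ℕ+ × ℕ+) :=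
  (Finset.Iio n ×ˢ Finset.Iio n).filter fun p => p.1 + p.2 = n

theorem mem_pairs {n : ℕ+} {p : ℕ+ × ℕ+} : p ∈ pairs n ↔ p.1 + p.2 = n := by
  simp only [pairs, Finset.mem_filter, Finset.mem_product, Finset.mem_Iio, and_iff_right_iff_imp]
  intro h
  exact ⟨h ▸ PNat.lt_add_right p.1 p.2, h ▸ PNat.lt_add_left p.2 p.1⟩

/-! ### The diamond and shuffle products

In the recursion for the shuffle product of two words `𝔞`, `𝔟`, the factor `x_{j,1}` is shuffled
with an element of `𝔇` which need not be a word. So the shuffle product of a letter and a word is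
defined first; that this is a special case of the shuffle product is `shuffle_letter`, and the
defining recursion of the two products is
`diamond_nil_left`, `diamond_nil_right`, `diamond_cons_cons`,
`shuffle_nil_left`, `shuffle_nil_right`, `shuffle_cons_cons`. -/

/-- The shuffle product of a letter (second argument) and a word (first argument). -/
def letterShuffleWord {F : Type*} [Field F] : Word F → Letter F → WordSpace F
  | [], x => ofWord [x]
  | c :: w, x =>
      ofWord (x :: c :: w) + prepend c (letterShuffleWord w x)
        + (ofWord ((x.1 + c.1, x.2 * c.2) :: w)
          + ∑ p ∈ pairs (x.1 + c.1), delta F p.2 x.1 c.1 •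
              prepend (p.1, x.2 * c.2) (letterShuffleWord w (p.2, 1)))

/-- The shuffle product with a letter, as a linear map. -/
def letterShuffle {F : Type*} [Field F] (x : Letter F) : WordSpace F →ₗ[F] WordSpace F :=
  Finsupp.linearCombination F fun w => letterShuffleWord w x

/-- The shuffle product of two words. -/
def shuffleWord {F : Type*} [Field F] : Word F → Word F → WordSpace F
  | [], b => ofWord b
  | x :: a, [] => ofWord (x :: a)
  | x :: a, y :: b =>
      prepend x (shuffleWord a (y :: b)) + prepend y (shuffleWord (x :: a) b)
        + (prepend (x.1 + y.1, x.2 * y.2) (shuffleWord a b)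
          + ∑ p ∈ pairs (x.1 + y.1), delta F p.2 x.1 y.1 •
              prepend (p.1, x.2 * y.2) (letterShuffle (p.2, 1) (shuffleWord a b)))
  termination_by a b => a.length + b.length

/-- The shuffle product on `𝔇`. -/
def shuffle {F : Type*} [Field F] : WordSpace F →ₗ[F] WordSpace F →ₗ[F] WordSpace F :=
  Finsupp.linearCombination F fun a => Finsupp.linearCombination F (shuffleWord a)

/-- The diamond product of two words. -/
def diamondWord {F : Type*} [Field F] : Word F → Word F → WordSpace F
  | [], b => ofWord b
  | x :: a, [] => ofWord (x :: a)
  | x :: a, y :: b =>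
      prepend (x.1 + y.1, x.2 * y.2) (shuffle (ofWord a) (ofWord b))
        + ∑ p ∈ pairs (x.1 + y.1), delta F p.2 x.1 y.1 • prepend (p.1, x.2 * y.2)
            (shuffle (ofWord [(p.2, 1)]) (shuffle (ofWord a) (ofWord b)))

/-- The diamond product on `𝔇`. -/
def diamond {F : Type*} [Field F] : WordSpace F →ₗ[F] WordSpace F →ₗ[F] WordSpace F :=
  Finsupp.linearCombination F fun a => Finsupp.linearCombination F (diamondWord a)

theorem shuffle_ofWord {F : Type*} [Field F] (a b : Word F) :
    shuffle (ofWord a) (ofWord b) = shuffleWord a b := by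
  simp [shuffle, ofWord]

theorem diamond_ofWord {F : Type*} [Field F] (a b : Word F) :
    diamond (ofWord a) (ofWord b) = diamondWord a b := by
  simp [diamond, ofWord]

theorem shuffle_nil_left {F : Type*} [Field F] (b : Word F) :
    shuffle (ofWord []) (ofWord b) = ofWord b := by
  rw [shuffle_ofWord, shuffleWord]

theorem shuffle_nil_right {F : Type*} [Field F] (a : Word F) :
    shuffle (ofWord a) (ofWord []) = ofWord a := by
  cases a <;> rw [shuffle_ofWord, shuffleWord]

theorem diamond_nil_left {F : Type*} [Field F] (b : Word F) :
    diamond (ofWord []) (ofWord b) = ofWord b := by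
  rw [diamond_ofWord, diamondWord]

theorem diamond_nil_right {F : Type*} [Field F] (a : Word F) :
    diamond (ofWord a) (ofWord []) = ofWord a := by
  cases a <;> rw [diamond_ofWord, diamondWord]

theorem letterShuffle_ofWord {F : Type*} [Field F] (x : Letter F) (w : Word F) :
    letterShuffle x (ofWord w) = letterShuffleWord w x := by
  simp [letterShuffle, ofWord]

theorem shuffleWord_letter {F : Type*} [Field F] (w : Word F) (x : Letter F) :
    shuffleWord [x] w = letterShuffleWord w x := by
  induction w generalizing x with
  | nil => rw [shuffleWord, letterShuffleWord]
  | cons c w ih =>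
    rw [shuffleWord, letterShuffleWord, ih]
    simp only [shuffleWord, prepend_ofWord, letterShuffle_ofWord]

theorem shuffle_letter {F : Type*} [Field F] (x : Letter F) :
    shuffle (ofWord [x]) = letterShuffle x := by
  ext1 w
  ext1
  have := (shuffle_ofWord [x] w).trans
    ((shuffleWord_letter w x).trans (letterShuffle_ofWord x w).symm)
  simpa [ofWord] using this

/-- The defining recursion of the diamond product. -/
theorem diamond_cons_cons {F : Type*} [Field F] (a b : ℕ+) (α β : Fˣ) (u v : Word F) :
    diamond (ofWord ((a, α) :: u)) (ofWord ((b, β) :: v)) =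
      prepend (a + b, α * β) (shuffle (ofWord u) (ofWord v))
        + ∑ p ∈ pairs (a + b), delta F p.2 a b • prepend (p.1, α * β)
            (shuffle (ofWord [(p.2, 1)]) (shuffle (ofWord u) (ofWord v))) := by
  rw [diamond_ofWord, diamondWord]

/-- The defining recursion of the shuffle product. -/
theorem shuffle_cons_cons {F : Type*} [Field F] (x y : Letter F) (u v : Word F) :
    shuffle (ofWord (x :: u)) (ofWord (y :: v)) =
      prepend x (shuffle (ofWord u) (ofWord (y :: v)))
        + prepend y (shuffle (ofWord (x :: u)) (ofWord v))
        + diamond (ofWord (x :: u)) (ofWord (y :: v)) := by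
  rw [diamond_ofWord, diamondWord]
  simp only [shuffle_letter, shuffle_ofWord]
  rw [shuffleWord]

/-! ### The coproduct -/

/-- The weight of a word over `Σ = {x_n}`; such a word `x_{i_1} ⋯ x_{i_m}` is the list
`[i_1, …, i_m]`, identified with the word `x_{i_1,1} ⋯ x_{i_m,1}` over `Γ`. -/
def weight (a : List ℕ+) : ℕ := (a.map PNat.val).sum

/-- The iterated shuffle product `x_{i_1,1} ⧢ ⋯ ⧢ x_{i_m,1}`, the empty word if `m = 0`. -/
def iteratedShuffle {F : Type*} [Field F] (a : List ℕ+) : WordSpace F :=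
  a.foldr (fun i z => shuffle (ofWord [(i, 1)]) z) (ofWord [])

/-- The bracket operator
`[𝔞] = (-1)^m Δ^{i_1}_{1,w(𝔞)+1} ⋯ Δ^{i_m}_{1,w(𝔞)+1} x_{i_1} ⧢ ⋯ ⧢ x_{i_m}`. -/
def bracket {F : Type*} [Field F] (a : List ℕ+) : WordSpace F :=
  ((-1) ^ a.length * (a.map fun i => delta F i 1 (weight a).succPNat).prod) • iteratedShuffle a

theorem finite_weight_eq (n : ℕ) : {a : List ℕ+ | weight a = n}.Finite := by
  induction n using Nat.strong_induction_on with
  | _ n ih =>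
    have hsub : {a : List ℕ+ | weight a = n} ⊆ {[]} ∪
        ⋃ r ∈ {r : ℕ+ | (r : ℕ) ≤ n}, List.cons r '' {a : List ℕ+ | weight a = n - r} := by
      rintro (_ | ⟨r, a⟩) h
      · simp
      · right
        simp only [weight, List.map_cons, List.sum_cons, Set.mem_ofPred_eq] at h
        simp only [Set.mem_iUnion, Set.mem_image, Set.mem_ofPred_eq]
        exact ⟨r, by omega, a, by simp only [weight]; omega, rfl⟩
    refine Set.Finite.subset (Set.Finite.union (Set.finite_singleton _)
      (Set.Finite.biUnion ?_ fun r hr => Set.Finite.image _ (ih _ ?_))) hsub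
    · exact Set.Finite.preimage (PNat.coe_injective.injOn) (Set.finite_Iic n)
    · have := r.pos
      simp only [Set.mem_ofPred_eq] at hr
      omega

theorem finite_index (n : ℕ+) :
    {p : ℕ+ × List ℕ+ | (p.1 : ℕ) + weight p.2 = n}.Finite := by
  refine Set.Finite.of_injOn (f := fun p : ℕ+ × List ℕ+ => p.1 :: p.2)
    (t := {a : List ℕ+ | weight a = n}) ?_ ?_ (finite_weight_eq n)
  · rintro ⟨r, a⟩ h
    simpa [weight] using h
  · rintro ⟨r, a⟩ _ ⟨s, b⟩ _ h
    simpa using h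

/-- The pairs `(r, 𝔞)` of a positive integer `r` and a word `𝔞` over `Σ` with `r + w(𝔞) = n`. -/
def index (n : ℕ+) : Finset (ℕ+ × List ℕ+) := (finite_index n).toFinset

theorem mem_index {n : ℕ+} {p : ℕ+ × List ℕ+} :
    p ∈ index n ↔ (p.1 : ℕ) + weight p.2 = n := by
  simp [index]

/-- The coefficient `binom (r + depth 𝔞 - 2) (depth 𝔞)`, with the generalized binomial
coefficient `binom a b = a (a - 1) ⋯ (a - b + 1) / b!` for an integer `a`. -/
def coproductCoeff (F : Type*) [Field F] (r : ℕ+) (a : List ℕ+) : F :=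
  ((Ring.choose (((r : ℕ) : ℤ) + (a.length : ℤ) - 2) a.length : ℤ) : F)

/-- The coproduct of a word. For `𝔲 = x_{u,ε} 𝔳`, with
`Δ(x_{u,ε}) = 1 ⊗ x_{u,ε} + ∑ c_{r,𝔞} x_{r,ε} ⊗ [𝔞]` (see `coproductWord_letter`), it is
`Δ(𝔲) = 1 ⊗ 𝔲 + ∑ c_{r,𝔞} (x_{r,ε} a_𝔳) ⊗ ([𝔞] ⧢ b_𝔳)` where `Δ(𝔳) = ∑ a_𝔳 ⊗ b_𝔳`. -/
def coproductWord {F : Type*} [Field F] : Word F → WordSpace F ⊗[F] WordSpace F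
  | [] => ofWord [] ⊗ₜ ofWord []
  | x :: v =>
      ofWord [] ⊗ₜ ofWord (x :: v)
        + ∑ p ∈ index x.1, coproductCoeff F p.1 p.2 •
            TensorProduct.map (prepend (p.1, x.2)) (shuffle (bracket p.2)) (coproductWord v)

theorem shuffle_one {F : Type*} [Field F] (z : WordSpace F) : shuffle z (ofWord []) = z := by
  have h : (shuffle (F := F)).flip (ofWord []) = LinearMap.id := by
    ext1 w
    ext1
    simpa [ofWord] using shuffle_nil_right w
  simpa using LinearMap.congr_fun h z

/-- The explicit formula for the coproduct in depth one. -/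
theorem coproductWord_letter {F : Type*} [Field F] (n : ℕ+) (ε : Fˣ) :
    coproductWord [((n, ε) : Letter F)] =
      ofWord [] ⊗ₜ[F] ofWord [(n, ε)]
        + ∑ p ∈ index n, coproductCoeff F p.1 p.2 • (ofWord [(p.1, ε)] ⊗ₜ[F] bracket p.2) := by
  simp only [coproductWord, TensorProduct.map_tmul, prepend_ofWord, shuffle_one]

/-- The coproduct `Δ : 𝔇 → 𝔇 ⊗ 𝔇`. -/
def coproduct {F : Type*} [Field F] : WordSpace F →ₗ[F] WordSpace F ⊗[F] WordSpace F :=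
  Finsupp.linearCombination F coproductWord

end AMZV

end

open scoped TensorProduct

/-! The coproduct is dual to the concatenation of towers. A tower is a list of steps `(z, k)` over
an extension `K` of `F`; its series `e` is the composite of the maps `T ↦ T - z ^ (q - 1) T ^ q`,
hence additive. A step `(z, k)` on top of a tower with series `e` gives `x_{n,ε}` the value `ε ^ k`
times the coefficient of `T ^ (n - 1)` in `z / (1 - z e(T))`. A word is evaluated by summing, over
all strictly descending choices of steps, the products of the values of its letters, in analogy with
truncated multiple zeta sums.

Three facts carry the proof. First, evaluation turns the shuffle product into multiplication
(`eval_shuffle`). This rests on a partial fraction identity for two letters at the same step, whose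
correction terms come from `T / e(T) = 1 + ∑ x_j T ^ j`, summed over `(q - 1) ∣ j` with `x_j`
standing for its value (`one_add_letterSeries_mul`, `letterValue_mul`).

Second, evaluating `Δ(w)` on a pair `(l', l)` gives the value of `w` on `l' ++ l`
(`evalTensor_coproduct`). Concatenation composes the series, and expanding `z / (1 - z e'(e(T)))`
requires the powers `e ^ (r - 1)`. Since `e / T` is the inverse of the series above, their
coefficients are the sums of brackets with the binomial coefficients of the coproduct
(`sum_eval_bracket`, `letterValue_append`).

Third, over an infinite `K` the evaluations separate words (`separating_evalWord`), and so triples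
of words. Both sides of coassociativity take at `(l₁, l₂, l₃)` the value of the word on `l₁ ++ l₂ ++
l₃`, so they agree. -/

namespace AMZV

open PowerSeries

/-! ### Geometric series in a power series without constant term -/

section Geometric

variable {K : Type*} [Field K]

/-- The series `1 / (1 - z e)`. -/
noncomputable def geomSeries (z : K) (e : K⟦X⟧) : K⟦X⟧ := (1 - C z * e)⁻¹

theorem geomSeries_mul (z : K) {e : K⟦X⟧} (he : constantCoeff e = 0) :
    geomSeries z e * (1 - C z * e) = 1 := by
  rw [geomSeries, PowerSeries.inv_mul_cancel]
  simp [he]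

theorem coeff_pow_eq_zero_of_lt {e : K⟦X⟧} (he : constantCoeff e = 0) {m n : ℕ} (h : n < m) :
    coeff n (e ^ m) = 0 :=
  X_pow_dvd_iff.mp (pow_dvd_pow_of_dvd (X_dvd_iff.mpr he) m) n h

theorem coeff_geomSeries (z : K) {e : K⟦X⟧} (he : constantCoeff e = 0) (n : ℕ) :
    coeff n (geomSeries z e) = ∑ m ∈ Finset.range (n + 1), z ^ m * coeff n (e ^ m) := by
  have h : geomSeries z e = ∑ m ∈ Finset.range (n + 1), (C z * e) ^ m
      + (C z * e) ^ (n + 1) * geomSeries z e := by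
    have h1 := geom_sum_mul_neg (C z * e) (n + 1)
    have h2 := geomSeries_mul z he
    linear_combination (-geomSeries z e) * h1
      + (∑ m ∈ Finset.range (n + 1), (C z * e) ^ m) * h2
  have h3 : coeff n ((C z * e) ^ (n + 1) * geomSeries z e) = 0 :=
    X_pow_dvd_iff.mp (Dvd.dvd.mul_right (pow_dvd_pow_of_dvd
      (X_dvd_iff.mpr (by simp [he])) _) _) n (Nat.lt_succ_self n)
  rw [h, map_add, h3, add_zero, map_sum]
  refine Finset.sum_congr rfl fun m _ => ?_
  rw [mul_pow, ← map_pow, coeff_C_mul]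

theorem coeff_geomSeries_subst (z : K) {e f : K⟦X⟧} (he : constantCoeff e = 0)
    (hf : constantCoeff f = 0) (n : ℕ) :
    coeff n (geomSeries z (subst f e)) =
      ∑ m ∈ Finset.range (n + 1), coeff m (geomSeries z e) * coeff n (f ^ m) := by
  have hs : HasSubst f := HasSubst.of_constantCoeff_zero' hf
  have h0 : constantCoeff (subst f e) = 0 := constantCoeff_subst_eq_zero hf _ he
  have h : geomSeries z (subst f e) = subst f (geomSeries z e) := by
    have h1 := congr_arg (subst (S := K) f) (geomSeries_mul z he)
    have hC : subst f (C z) = C z := subst_C z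
    have h11 : subst (S := K) f (1 : K⟦X⟧) = (1 : K⟦X⟧) := by
      rw [← coe_substAlgHom hs, map_one]
    rw [subst_mul hs, subst_sub hs, subst_mul hs, hC, h11] at h1
    have h2 := geomSeries_mul z h0
    have h3 : (1 - C z * subst f e) ≠ 0 := fun h => by simp [h] at h2
    exact mul_right_cancel₀ h3 (h2.trans h1.symm)
  rw [h, coeff_subst' hs, finsum_eq_sum_of_support_subset]
  · rfl
  · intro m hm
    by_contra hlt
    simp only [Finset.coe_range, Set.mem_Iio, not_lt] at hlt
    exact hm (by simp only [coeff_pow_eq_zero_of_lt hf (show n < m by omega), smul_zero])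

end Geometric

/-! ### Exponents of power series modulo `d` -/

section Residue

variable {K : Type*} [Field K]

/-- The part of a power series supported in the degrees `n` with `d ∣ n + 1`. -/
noncomputable def residuePart (d : ℕ) : K⟦X⟧ →ₗ[K] K⟦X⟧ where
  toFun f := PowerSeries.mk fun n => if d ∣ n + 1 then coeff n f else 0
  map_add' f g := by ext n; simp only [coeff_mk, map_add]; split_ifs <;> simp
  map_smul' c f := by ext n; simp only [coeff_mk, map_smul]; split_ifs <;> simp

theorem coeff_residuePart (d : ℕ) (f : K⟦X⟧) (n : ℕ) :
    coeff n (residuePart d f) = if d ∣ n + 1 then coeff n f else 0 := by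
  simp [residuePart]

/-- The power series supported in the degrees congruent to `r` modulo `d`. -/
def SupportedMod (d r : ℕ) (f : K⟦X⟧) : Prop := ∀ n, coeff n f ≠ 0 → n ≡ r [MOD d]

theorem SupportedMod.mul {d r s : ℕ} {f g : K⟦X⟧} (hf : SupportedMod d r f)
    (hg : SupportedMod d s g) : SupportedMod d (r + s) (f * g) := by
  intro n hn
  rw [coeff_mul] at hn
  obtain ⟨p, hp, hne⟩ := Finset.exists_ne_zero_of_sum_ne_zero hn
  rw [← Finset.HasAntidiagonal.mem_antidiagonal.mp hp]
  exact (hf _ (left_ne_zero_of_mul hne)).add (hg _ (right_ne_zero_of_mul hne))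

theorem supportedMod_C (d : ℕ) (c : K) : SupportedMod d 0 (C c) := by
  intro n hn
  rw [coeff_C] at hn
  obtain rfl : n = 0 := by by_contra h; simp [h] at hn
  rfl

theorem SupportedMod.pow {d r : ℕ} {f : K⟦X⟧} (hf : SupportedMod d r f) (m : ℕ) :
    SupportedMod d (m * r) (f ^ m) := by
  induction m with
  | zero => simpa using supportedMod_C (K := K) d 1
  | succ m ih => rw [pow_succ, add_mul, one_mul]; exact ih.mul hf

theorem SupportedMod.sub {d r : ℕ} {f g : K⟦X⟧} (hf : SupportedMod d r f)
    (hg : SupportedMod d r g) : SupportedMod d r (f - g) := by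
  intro n hn
  by_cases h : coeff n f = 0
  · exact hg n fun h' => hn (by simp [h, h'])
  · exact hf n h

theorem SupportedMod.of_modEq {d r s : ℕ} {f : K⟦X⟧} (hf : SupportedMod d r f)
    (h : r ≡ s [MOD d]) : SupportedMod d s f := fun n hn => (hf n hn).trans h

theorem SupportedMod.residuePart_eq_self {d r : ℕ} {f : K⟦X⟧} (hf : SupportedMod d r f)
    (h : d ∣ r + 1) : residuePart d f = f := by
  ext n
  rw [coeff_residuePart]
  split_ifs with hn
  · rfl
  · by_contra h0
    exact hn ((((hf n (Ne.symm h0)).add_right 1).dvd_iff dvd_rfl).mpr h)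

theorem SupportedMod.residuePart_eq_zero {d r : ℕ} {f : K⟦X⟧} (hf : SupportedMod d r f)
    (h : ¬ d ∣ r + 1) : residuePart d f = 0 := by
  ext n
  rw [coeff_residuePart]
  split_ifs with hn
  · by_contra h0
    exact h ((((hf n h0).add_right 1).dvd_iff dvd_rfl).mp hn)
  · simp

/-- Multiplication by a series in degrees divisible by `d` preserves residue classes of exponents,
so the projection is linear over such series. -/
theorem residuePart_mul {d : ℕ} (f : K⟦X⟧) {g : K⟦X⟧} (hg : SupportedMod d 0 g) :
    residuePart d (f * g) = residuePart d f * g := by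
  ext n
  rw [coeff_residuePart, coeff_mul, coeff_mul]
  have key : ∀ p ∈ Finset.HasAntidiagonal.antidiagonal n, coeff p.1 (residuePart d f) * coeff p.2 g =
      if d ∣ n + 1 then coeff p.1 f * coeff p.2 g else 0 := by
    intro p hp
    by_cases h0 : coeff p.2 g = 0
    · simp [h0]
    · have h1 : d ∣ p.2 := (Nat.modEq_zero_iff_dvd).mp (hg _ h0)
      have h2 : d ∣ p.1 + 1 ↔ d ∣ n + 1 := by
        rw [← Finset.HasAntidiagonal.mem_antidiagonal.mp hp, show p.1 + p.2 + 1 = p.1 + 1 + p.2 by ring]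
        exact (Nat.dvd_add_left h1).symm
      rw [coeff_residuePart]
      simp only [h2]
      split_ifs <;> simp
  rw [Finset.sum_congr rfl key]
  split_ifs <;> simp

end Residue

/-! ### Additive series of towers -/

section Tower

variable (F : Type*) [Field F]

theorem pow_natCard_sub_one (x : Fˣ) : x ^ (Nat.card F - 1) = 1 := by
  rw [← Nat.card_units, pow_card_eq_one']

theorem neg_one_pow_of_dvd {A : Type*} [CommRing A] [Algebra F A] {n : ℕ}
    (h : Nat.card F - 1 ∣ n) : (-1 : A) ^ n = 1 := by
  obtain ⟨m, rfl⟩ := h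
  have h1 : (-1 : A) ^ (Nat.card F - 1) = 1 := by
    have := congr_arg (fun u : Fˣ => algebraMap F A u) (pow_natCard_sub_one F (-1))
    simpa using this
  rw [pow_mul, h1, one_pow]

theorem add_pow_natCard [Finite F] {A : Type*} [CommRing A] [Algebra F A] (x y : A) :
    (x + y) ^ Nat.card F = x ^ Nat.card F + y ^ Nat.card F := by
  have := Fintype.ofFinite F
  simpa [Nat.card_eq_fintype_card] using map_add (FiniteField.frobeniusAlgHom F A) x y

variable {K : Type*} [Field K]

/-- The additive power series attached to a tower: each step `(z, k)` replaces `e` by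
`e - z ^ (q - 1) e ^ q`. -/
noncomputable def towerSeries : List (K × ℕ) → K⟦X⟧
  | [] => X
  | s :: l => towerSeries l - C (s.1 ^ (Nat.card F - 1)) * towerSeries l ^ Nat.card F

variable [Finite F]

theorem constantCoeff_towerSeries (l : List (K × ℕ)) : constantCoeff (towerSeries F l) = 0 := by
  induction l with
  | nil => simp [towerSeries]
  | cons s l ih => simp [towerSeries, ih, Nat.card_pos.ne']

/-- Each step composes on the outside with `T - z ^ (q - 1) T ^ q`, so the lower tower `l` ends up
as the inner series. This is the source of the coproduct formula. -/
theorem towerSeries_append (l' l : List (K × ℕ)) :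
    towerSeries F (l' ++ l) = subst (towerSeries F l) (towerSeries F l') := by
  have hs : HasSubst (towerSeries F l) :=
    HasSubst.of_constantCoeff_zero' (constantCoeff_towerSeries F l)
  induction l' with
  | nil => simp [towerSeries, subst_X hs]
  | cons s l' ih =>
    have hC (c : K) : subst (towerSeries F l) (C c) = C c := subst_C c
    simp only [List.cons_append, towerSeries, ih, subst_sub hs, subst_mul hs, subst_pow hs, hC]

/-- Since `q ≡ 1` modulo `q - 1`, taking `q`-th powers keeps the exponents in the class of `1`. -/
theorem supportedMod_towerSeries (l : List (K × ℕ)) :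
    SupportedMod (Nat.card F - 1) 1 (towerSeries F l) := by
  have hq : 1 < Nat.card F := Finite.one_lt_card
  induction l with
  | nil =>
    intro n hn
    rw [towerSeries, coeff_X] at hn
    obtain rfl : n = 1 := by by_contra h; simp [h] at hn
    rfl
  | cons s l ih =>
    refine ih.sub (((supportedMod_C _ _).mul (ih.pow _)).of_modEq ?_)
    rw [zero_add, mul_one]
    conv_lhs => rw [show Nat.card F = 1 + (Nat.card F - 1) by omega]
    exact Nat.add_modEq_right

/-- With `e` the tower series, `(1 - (z e) ^ (q - 1)) / (1 - z e)` is the sum of `(z e) ^ m` for `m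
< q - 1`. The `m`-th term has exponents congruent to `m`, so only `m = q - 2` survives the
projection. -/
theorem residuePart_geomSeries (s : K × ℕ) (l : List (K × ℕ)) :
    residuePart (Nat.card F - 1) (C s.1 * geomSeries s.1 (towerSeries F l)) *
        (1 - (C s.1 * towerSeries F l) ^ (Nat.card F - 1)) =
      C s.1 * (C s.1 * towerSeries F l) ^ (Nat.card F - 2) := by
  have hq : 1 < Nat.card F := Finite.one_lt_card
  set e := towerSeries F l
  have hze : SupportedMod (Nat.card F - 1) 1 (C s.1 * e) :=
    ((supportedMod_C _ _).mul (supportedMod_towerSeries F l)).of_modEq (by rfl)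
  have hpow (m : ℕ) : SupportedMod (Nat.card F - 1) m (C s.1 * (C s.1 * e) ^ m) :=
    ((supportedMod_C _ _).mul (hze.pow m)).of_modEq (by simp [Nat.ModEq])
  have h0 : SupportedMod (Nat.card F - 1) 0 (1 - (C s.1 * e) ^ (Nat.card F - 1)) := by
    refine SupportedMod.sub ?_ ((hze.pow _).of_modEq (by simp [Nat.ModEq]))
    simpa using supportedMod_C (K := K) (Nat.card F - 1) 1
  have h1 : C s.1 * geomSeries s.1 e * (1 - (C s.1 * e) ^ (Nat.card F - 1)) =
      ∑ m ∈ Finset.range (Nat.card F - 1), C s.1 * (C s.1 * e) ^ m := by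
    have h2 := geomSeries_mul s.1 (constantCoeff_towerSeries F l)
    have h3 := geom_sum_mul_neg (C s.1 * e) (Nat.card F - 1)
    rw [← Finset.mul_sum]
    linear_combination (-C s.1 * geomSeries s.1 e) * h3
      + C s.1 * (∑ m ∈ Finset.range (Nat.card F - 1), (C s.1 * e) ^ m) * h2
  rw [← residuePart_mul _ h0, h1, map_sum, Finset.sum_eq_single (Nat.card F - 2)]
  · exact (hpow _).residuePart_eq_self ⟨1, by omega⟩
  · intro m hm hne
    refine (hpow m).residuePart_eq_zero fun hdvd => ?_
    have := Nat.le_of_dvd (Nat.succ_pos m) hdvd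
    have := Finset.mem_range.mp hm
    omega
  · intro h
    exact absurd (Finset.mem_range.mpr (by omega)) h

end Tower

/-! ### Evaluation of words on towers -/

section Evaluation

variable {F K : Type*} [Field F] [Field K] [Algebra F K]

/-- The coefficient of `T ^ (n - 1)` in `z / (1 - z e(T))`, for the next step `z` of a tower. -/
noncomputable def letterValue (F : Type*) [Field F] {K : Type*} [Field K]
    (z : K) (l : List (K × ℕ)) (n : ℕ+) : K :=
  z * coeff n.natPred (geomSeries z (towerSeries F l))

/-- The value of a word on a tower. -/
noncomputable def evalWord : List (K × ℕ) → Word F → K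
  | [], [] => 1
  | [], _ :: _ => 0
  | _ :: _, [] => 1
  | s :: l, x :: u => evalWord l (x :: u) +
      algebraMap F K (x.2 ^ s.2) * letterValue F s.1 l x.1 * evalWord l u

/-- The value on a tower, as a linear map. -/
noncomputable def eval (l : List (K × ℕ)) : WordSpace F →ₗ[F] K :=
  Finsupp.linearCombination F (evalWord l)

theorem eval_ofWord (l : List (K × ℕ)) (w : Word F) : eval l (ofWord w) = evalWord l w := by
  simp [eval, ofWord]

theorem evalWord_nil (l : List (K × ℕ)) : evalWord l ([] : Word F) = 1 := by
  cases l <;> rfl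

theorem wordSpace_ext {V : Type*} [AddCommMonoid V] [Module F V] {f g : WordSpace F →ₗ[F] V}
    (h : ∀ w, f (ofWord w) = g (ofWord w)) : f = g :=
  Finsupp.lhom_ext' fun w => LinearMap.ext_ring (h w)

theorem eval_nil_prepend (x : Letter F) (f : WordSpace F) :
    eval ([] : List (K × ℕ)) (prepend x f) = 0 := by
  have : eval ([] : List (K × ℕ)) ∘ₗ prepend x = 0 := by
    refine wordSpace_ext fun w => ?_
    simp [eval_ofWord, evalWord]
  exact LinearMap.congr_fun this f

theorem eval_cons_prepend (s : K × ℕ) (l : List (K × ℕ)) (x : Letter F) (f : WordSpace F) :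
    eval (s :: l) (prepend x f) = eval l (prepend x f) +
      algebraMap F K (x.2 ^ s.2) * letterValue F s.1 l x.1 * eval l f := by
  have : eval (s :: l) ∘ₗ prepend x = eval l ∘ₗ prepend x +
      LinearMap.mulLeft F (algebraMap F K (x.2 ^ s.2) * letterValue F s.1 l x.1) ∘ₗ eval l := by
    refine wordSpace_ext fun w => ?_
    simp [eval_ofWord, evalWord, mul_assoc]
  exact LinearMap.congr_fun this f

/-- The generating series of the values of the letters `x_{j,1}` with `(q - 1) ∣ j`. -/
noncomputable def letterSeries (F : Type*) {K : Type*} [Field F] [Field K] [Algebra F K]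
    (l : List (K × ℕ)) : K⟦X⟧ :=
  residuePart (Nat.card F - 1) (PowerSeries.mk fun n => evalWord l ([(n.succPNat, 1)] : Word F))

theorem coeff_letterSeries (l : List (K × ℕ)) (n : ℕ) :
    coeff n (letterSeries F l) = if Nat.card F - 1 ∣ n + 1 then
      evalWord l ([(n.succPNat, 1)] : Word F) else 0 := by
  rw [letterSeries, coeff_residuePart, coeff_mk]

/-- In other words, `1 / e = 1 / T + L` with `L` the letter series. Adding a step replaces `1 / e`
by `1 / (e (1 - (z e) ^ (q - 1)))`, which exceeds `1 / e` by `z (z e) ^ (q - 2) / (1 - (z e) ^ (q -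
1))`. By `residuePart_geomSeries` this is exactly the contribution of the new step to `L`. -/
theorem one_add_letterSeries_mul [Finite F] (l : List (K × ℕ)) :
    (1 + X * letterSeries F l) * towerSeries F l = X := by
  have hq : 1 < Nat.card F := Finite.one_lt_card
  induction l with
  | nil =>
    have : letterSeries F ([] : List (K × ℕ)) = 0 := by
      ext n
      simp [coeff_letterSeries, evalWord]
    simp [this, towerSeries]
  | cons s l ih =>
    have h1 : letterSeries F (s :: l) = letterSeries F l +
        residuePart (Nat.card F - 1) (C s.1 * geomSeries s.1 (towerSeries F l)) := by
      rw [letterSeries, letterSeries, ← map_add]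
      congr 1
      ext n
      simp [evalWord, letterValue, evalWord_nil]
    have h2 := residuePart_geomSeries F s l
    rw [h1, towerSeries]
    obtain ⟨m, hm⟩ : ∃ m, Nat.card F = m + 2 := ⟨Nat.card F - 2, by omega⟩
    simp only [hm, Nat.add_sub_cancel, show m + 2 - 1 = m + 1 by omega, map_pow] at h2 ⊢
    linear_combination (1 - (C s.1 * towerSeries F l) ^ (m + 1)) * ih
      + X * towerSeries F l * h2

theorem coeff_subst_single_mul {σ : Type*} [DecidableEq σ] (s : σ) (f : K⟦X⟧)
    (g : MvPowerSeries σ K) (d : σ →₀ ℕ) :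
    MvPowerSeries.coeff d (subst (MvPowerSeries.X s) f * g) =
      ∑ p ∈ Finset.HasAntidiagonal.antidiagonal (d s),
        coeff p.1 f * MvPowerSeries.coeff (d.update s p.2) g := by
  rw [MvPowerSeries.coeff_mul]
  symm
  refine Finset.sum_of_injOn (fun p => (Finsupp.single s p.1, d.update s p.2)) ?_ ?_ ?_ ?_
  · rintro ⟨a, b⟩ _ ⟨a', b'⟩ _ h
    simp only [Prod.mk.injEq] at h
    have h1 := DFunLike.congr_fun h.1 s
    have h2 := DFunLike.congr_fun h.2 s
    simp at h1 h2
    simp [h1, h2]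
  · rintro ⟨a, b⟩ h
    simp only [Finset.mem_coe, Finset.HasAntidiagonal.mem_antidiagonal] at h ⊢
    ext t
    by_cases ht : t = s
    · subst ht; simpa using h
    · simp [ht]
  · rintro ⟨a, b⟩ h hn
    simp only [Finset.HasAntidiagonal.mem_antidiagonal] at h
    rw [coeff_subst_single]
    split_ifs with ha
    · refine absurd ⟨(a s, b s), ?_, ?_⟩ hn
      · simp [← h]
      · simp only [Prod.mk.injEq]
        refine ⟨ha.symm, ?_⟩
        ext t
        by_cases ht : t = s
        · subst ht; simp
        · rw [← h]
          change a = _ at ha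
          rw [ha]
          simp [ht]
    · simp
  · rintro ⟨a, b⟩ _
    simp [coeff_subst_single]

end Evaluation

/-! ### Partial fractions and the product of two letters -/

section LetterProduct

variable {K : Type*} [Field K]

theorem X_mul_coeff {σ : Type*} [DecidableEq σ] (s : σ) (g : MvPowerSeries σ K) (d : σ →₀ ℕ) :
    MvPowerSeries.coeff d (MvPowerSeries.X s * g) =
      if d s = 0 then 0 else MvPowerSeries.coeff (d.update s (d s - 1)) g := by
  rw [show MvPowerSeries.X s = subst (MvPowerSeries.X s : MvPowerSeries σ K) (X : K⟦X⟧) from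
    (subst_X (HasSubst.X s)).symm, coeff_subst_single_mul]
  cases h : d s with
  | zero => simp
  | succ n =>
    rw [Finset.sum_eq_single (1, n)]
    · simp
    · rintro ⟨a, b⟩ hab hne
      have : a ≠ 1 := by
        rintro rfl
        refine hne ?_
        have := Finset.HasAntidiagonal.mem_antidiagonal.mp hab
        simp only [Prod.mk.injEq, true_and]
        omega
      simp [coeff_X, this]
    · intro hn
      exact absurd (Finset.HasAntidiagonal.mem_antidiagonal.mpr (add_comm _ _)) hn

theorem coeff_subst_zero_mul_subst_one (f g : K⟦X⟧) (d : Fin 2 →₀ ℕ) :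
    MvPowerSeries.coeff d (subst (MvPowerSeries.X 0 : MvPowerSeries (Fin 2) K) f *
      subst (MvPowerSeries.X 1 : MvPowerSeries (Fin 2) K) g) = coeff (d 0) f * coeff (d 1) g := by
  rw [coeff_subst_single_mul, Finset.sum_eq_single (d 0, 0)]
  · rw [coeff_subst_single, if_pos]
    · simp
    · ext t; fin_cases t <;> simp
  · rintro ⟨a, b⟩ hab hne
    rw [coeff_subst_single, if_neg, mul_zero]
    intro h
    have h0 := DFunLike.congr_fun h 0
    simp at h0
    have := Finset.HasAntidiagonal.mem_antidiagonal.mp hab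
    simp_all
  · intro hn
    exact absurd (Finset.HasAntidiagonal.mem_antidiagonal.mpr (add_zero _)) hn

theorem sum_antidiagonal_add {M : Type*} [AddCommMonoid M] (a b : ℕ) (g : ℕ → ℕ → M)
    (hg : ∀ m n, n < b → g m n = 0) :
    ∑ p ∈ Finset.HasAntidiagonal.antidiagonal (a + b), g p.1 p.2 =
      ∑ p ∈ Finset.HasAntidiagonal.antidiagonal a, g p.1 (p.2 + b) := by
  symm
  refine Finset.sum_of_injOn (fun p => (p.1, p.2 + b)) ?_ ?_ ?_ ?_
  · rintro ⟨x, y⟩ _ ⟨x', y'⟩ _ h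
    simpa using h
  · rintro ⟨x, y⟩ h
    simp only [Finset.mem_coe, Finset.HasAntidiagonal.mem_antidiagonal] at h ⊢
    omega
  · rintro ⟨x, y⟩ h hn
    simp only [Finset.HasAntidiagonal.mem_antidiagonal] at h
    refine hg _ _ (lt_of_not_ge fun hle => hn ⟨(x, y - b), ?_, ?_⟩)
    · simp only [Finset.mem_coe, Finset.HasAntidiagonal.mem_antidiagonal]
      omega
    · simp only [Prod.mk.injEq, true_and]
      omega
  · intros; rfl

theorem sum_pairs {M : Type*} [AddCommMonoid M] (a b : ℕ+) (g : ℕ+ × ℕ+ → M) :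
    ∑ p ∈ pairs (a + b), g p =
      ∑ p ∈ Finset.HasAntidiagonal.antidiagonal (a.natPred + b.natPred),
        g (p.1.succPNat, p.2.succPNat) := by
  symm
  refine Finset.sum_nbij' (fun p => (p.1.succPNat, p.2.succPNat))
    (fun p => (p.1.natPred, p.2.natPred)) ?_ ?_ ?_ ?_ ?_
  · rintro ⟨m, n⟩ h
    rw [Finset.HasAntidiagonal.mem_antidiagonal] at h
    rw [mem_pairs, ← PNat.coe_inj]
    have := a.natPred_add_one
    have := b.natPred_add_one
    simp only [PNat.add_coe, Nat.succPNat_coe] at h ⊢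
    omega
  · rintro ⟨m, n⟩ h
    rw [mem_pairs, ← PNat.coe_inj] at h
    rw [Finset.HasAntidiagonal.mem_antidiagonal]
    have := a.natPred_add_one
    have := b.natPred_add_one
    have := m.natPred_add_one
    have := n.natPred_add_one
    simp only [PNat.add_coe] at h ⊢
    omega
  · rintro ⟨m, n⟩ _; simp
  · rintro ⟨m, n⟩ _; simp
  · rintro ⟨m, n⟩ _; simp

variable {F : Type*} [Field F] [Finite F] [Algebra F K]

theorem rescale_neg_one_towerSeries (l : List (K × ℕ)) :
    rescale (-1) (towerSeries F l) = -towerSeries F l := by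
  have hodd : (-1 : K⟦X⟧) ^ Nat.card F = -1 := by
    have h := neg_one_pow_of_dvd F (A := K⟦X⟧) (dvd_refl (Nat.card F - 1))
    rw [show Nat.card F = Nat.card F - 1 + 1 from (Nat.sub_add_cancel Nat.card_pos).symm,
      pow_succ, h, one_mul]
  have hC (c : K) : rescale (-1) (C c) = C c := by
    ext n
    rw [coeff_rescale, coeff_C]
    split_ifs with h <;> simp [h]
  induction l with
  | nil => simp [towerSeries]
  | cons s l ih =>
    simp only [towerSeries, map_sub, map_mul, map_pow, ih, hC]
    rw [neg_pow (towerSeries F l), hodd]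
    ring

/-- The `q`-th power map is additive on `F`-algebras, so each step preserves additivity. -/
theorem subst_add_towerSeries (l : List (K × ℕ)) :
    subst (MvPowerSeries.X 0 + MvPowerSeries.X 1 : MvPowerSeries (Fin 2) K) (towerSeries F l) =
      subst (MvPowerSeries.X 0 : MvPowerSeries (Fin 2) K) (towerSeries F l) +
        subst (MvPowerSeries.X 1 : MvPowerSeries (Fin 2) K) (towerSeries F l) := by
  have h0 : HasSubst (MvPowerSeries.X 0 : MvPowerSeries (Fin 2) K) := HasSubst.X 0
  have h1 : HasSubst (MvPowerSeries.X 1 : MvPowerSeries (Fin 2) K) := HasSubst.X 1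
  have h := h0.add h1
  induction l with
  | nil => simp [towerSeries, subst_X h0, subst_X h1, subst_X h]
  | cons s l ih =>
    simp only [towerSeries, subst_sub h0, subst_sub h1, subst_sub h, subst_mul h0, subst_mul h1,
      subst_mul h, subst_pow h0, subst_pow h1, subst_pow h, subst_C, ih, add_pow_natCard F]
    ring

/-- The series `(f(S) - f(-T)) / (S + T)` in two variables. -/
noncomputable def dividedDifference (f : K⟦X⟧) : MvPowerSeries (Fin 2) K :=
  fun d => (-1) ^ d 1 * coeff (d 0 + d 1 + 1) f

theorem coeff_dividedDifference (f : K⟦X⟧) (d : Fin 2 →₀ ℕ) :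
    MvPowerSeries.coeff d (dividedDifference f) = (-1) ^ d 1 * coeff (d 0 + d 1 + 1) f := rfl

theorem add_mul_dividedDifference (f : K⟦X⟧) :
    (MvPowerSeries.X 0 + MvPowerSeries.X 1) * dividedDifference f =
      subst (MvPowerSeries.X 0 : MvPowerSeries (Fin 2) K) f -
        subst (MvPowerSeries.X 1 : MvPowerSeries (Fin 2) K) (rescale (-1) f) := by
  ext d
  rw [add_mul, map_add, map_sub, X_mul_coeff, X_mul_coeff, coeff_subst_single,
    coeff_subst_single, coeff_rescale]
  have i0 : (d = Finsupp.single 0 (d 0)) ↔ d 1 = 0 := by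
    rw [Finsupp.ext_iff, Fin.forall_fin_two]; simp
  have i1 : (d = Finsupp.single 1 (d 1)) ↔ d 0 = 0 := by
    rw [Finsupp.ext_iff, Fin.forall_fin_two]; simp [eq_comm]
  simp only [i0, i1, coeff_dividedDifference]
  rcases hd0 : d 0 with _ | m <;> rcases hd1 : d 1 with _ | n <;>
    simp [hd0, hd1, pow_succ, add_comm, add_left_comm]

/-- The two-variable form of the partial fraction decomposition of a product of letters. -/
theorem geomSeries_subst_mul (z : K) (l : List (K × ℕ)) :
    MvPowerSeries.C z * (subst (MvPowerSeries.X 0 : MvPowerSeries (Fin 2) K)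
          (geomSeries z (towerSeries F l)) *
        subst (MvPowerSeries.X 1 : MvPowerSeries (Fin 2) K)
          (rescale (-1) (geomSeries z (towerSeries F l)))) =
      dividedDifference (geomSeries z (towerSeries F l)) +
      (subst (MvPowerSeries.X 0 : MvPowerSeries (Fin 2) K) (geomSeries z (towerSeries F l)) *
          subst (MvPowerSeries.X 0 + MvPowerSeries.X 1 : MvPowerSeries (Fin 2) K)
            (letterSeries F l) -
        subst (MvPowerSeries.X 1 : MvPowerSeries (Fin 2) K)
            (rescale (-1) (geomSeries z (towerSeries F l))) *
          subst (MvPowerSeries.X 0 + MvPowerSeries.X 1 : MvPowerSeries (Fin 2) K)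
            (letterSeries F l)) := by
  set S : MvPowerSeries (Fin 2) K := MvPowerSeries.X 0
  set T : MvPowerSeries (Fin 2) K := MvPowerSeries.X 1
  set G := geomSeries z (towerSeries F l) with hG
  set D := dividedDifference G
  have h0 : HasSubst S := HasSubst.X 0
  have h1 : HasSubst T := HasSubst.X 1
  have h := h0.add h1
  have hone {a : MvPowerSeries (Fin 2) K} (ha : HasSubst a) : subst a (1 : K⟦X⟧) = 1 := by
    rw [← coe_substAlgHom ha, map_one]
  have hgeom := geomSeries_mul z (constantCoeff_towerSeries F l)
  rw [← hG] at hgeom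
  have e1 : subst S G * (1 - MvPowerSeries.C z * subst S (towerSeries F l)) = 1 := by
    have := congr_arg (subst S) hgeom
    simpa only [subst_mul h0, subst_sub h0, hone h0, subst_C] using this
  have e2 : subst T (rescale (-1) G) *
      (1 + MvPowerSeries.C z * subst T (towerSeries F l)) = 1 := by
    have hC : rescale (-1) (C z) = C z := by
      ext n
      rw [coeff_rescale, coeff_C]
      split_ifs with h <;> simp [h]
    have h2 := congr_arg (rescale (-1)) hgeom
    rw [map_mul, map_sub, map_mul, map_one, rescale_neg_one_towerSeries, hC, mul_neg,
      sub_neg_eq_add] at h2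
    have := congr_arg (subst T) h2
    simpa only [subst_mul h1, subst_add h1, hone h1, subst_C] using this
  have e3 : (1 + (S + T) * subst (S + T) (letterSeries F l)) *
      (subst S (towerSeries F l) + subst T (towerSeries F l)) = S + T := by
    have := congr_arg (subst (S + T)) (one_add_letterSeries_mul (F := F) l)
    rw [← subst_add_towerSeries]
    simpa only [subst_mul h, subst_add h, hone h, subst_X h] using this
  have e4 : (S + T) * D = subst S G - subst T (rescale (-1) G) := add_mul_dividedDifference G
  have hST : S + T ≠ 0 := by
    intro h
    have := congr_arg (MvPowerSeries.coeff (Finsupp.single 0 1)) h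
    simp [S, T, MvPowerSeries.coeff_X, Finsupp.single_left_inj] at this
  have hE : subst S (towerSeries F l) + subst T (towerSeries F l) ≠ 0 := by
    intro h
    rw [h, mul_zero] at e3
    exact hST e3.symm
  -- By additivity, `G(S) - G(-T) = z e(S + T) G(S) G(-T)`. The claim is this identity divided by
  -- `e(S + T)`, with `1 / e(S + T) = 1 / (S + T) + L(S + T)`; the denominators are cleared first.
  refine mul_left_cancel₀ (mul_ne_zero hST hE) ?_
  linear_combination
    (-(subst S (towerSeries F l) + subst T (towerSeries F l))) * e4
      - (subst S G - subst T (rescale (-1) G)) * e3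
      + (S + T) * subst S G * e2 - (S + T) * subst T (rescale (-1) G) * e1

/-- This compares coefficients of `S ^ (a - 1) T ^ (b - 1)` in `geomSeries_subst_mul`: the divided
difference yields the letter of index `a + b`, and expanding `L(S + T)` yields the binomials in
`delta`. -/
theorem letterValue_mul (z : K) (l : List (K × ℕ)) (a b : ℕ+) :
    letterValue F z l a * letterValue F z l b = letterValue F z l (a + b) +
      ∑ p ∈ pairs (a + b), algebraMap F K (delta F p.2 a b) * letterValue F z l p.1 *
        evalWord l ([(p.2, 1)] : Word F) := by
  set d : Fin 2 →₀ ℕ := Finsupp.single 0 a.natPred + Finsupp.single 1 b.natPred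
  have d0 : d 0 = a.natPred := by simp [d]
  have d1 : d 1 = b.natPred := by simp [d]
  have h := congr_arg (MvPowerSeries.coeff d) (geomSeries_subst_mul (F := F) z l)
  set G := geomSeries z (towerSeries F l)
  rw [MvPowerSeries.coeff_C_mul, coeff_subst_zero_mul_subst_one, map_add, map_sub,
    coeff_subst_single_mul, coeff_subst_single_mul] at h
  simp only [coeff_dividedDifference, coeff_rescale, coeff_subst_X_zero_add_X_one, d0, d1,
    Finsupp.update_apply] at h
  simp only [Fin.isValue, one_ne_zero, zero_ne_one, ↓reduceIte] at h
  have hsum : ∑ p ∈ pairs (a + b), algebraMap F K (delta F p.2 a b) * letterValue F z l p.1 *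
        evalWord l ([(p.2, 1)] : Word F) =
      z * ∑ p ∈ Finset.HasAntidiagonal.antidiagonal (b.natPred + a.natPred), coeff p.1 G *
        ((-1) ^ a.natPred * (p.2.choose a.natPred) * coeff p.2 (letterSeries F l)) +
      z * ∑ p ∈ Finset.HasAntidiagonal.antidiagonal (a.natPred + b.natPred), coeff p.1 G *
        ((-1) ^ b.natPred * (p.2.choose b.natPred) * coeff p.2 (letterSeries F l)) := by
    rw [sum_pairs, add_comm b.natPred, Finset.mul_sum, Finset.mul_sum, ← Finset.sum_add_distrib]
    refine Finset.sum_congr rfl fun p _ => ?_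
    simp only [delta, coeff_letterSeries, letterValue, Nat.succPNat_coe, Nat.succ_eq_add_one,
      Nat.natPred_succPNat, Nat.add_sub_cancel]
    split_ifs
    · simp only [map_add, map_mul, map_pow, map_neg, map_one, map_natCast]
      simp only [PNat.natPred, G]
      ring
    · simp
  -- The binomials vanish for small `j`, which shortens the two sums to the ranges produced by the
  -- two-variable expansion.
  rw [hsum, sum_antidiagonal_add _ _ fun m n => coeff m G *
      ((-1) ^ a.natPred * (n.choose a.natPred) * coeff n (letterSeries F l)),
    sum_antidiagonal_add _ _ fun m n => coeff m G *
      ((-1) ^ b.natPred * (n.choose b.natPred) * coeff n (letterSeries F l))]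
  rotate_left
  · intro m n hn; simp [Nat.choose_eq_zero_of_lt hn]
  · intro m n hn; simp [Nat.choose_eq_zero_of_lt hn]
  have hB : ((-1 : K) ^ b.natPred) * (-1) ^ b.natPred = 1 := by
    rw [← mul_pow]; simp
  -- The signs match because only `j` with `(q - 1) ∣ j` contribute, and then `(-1) ^ j = 1` in `K`.
  have h1 : ∑ p ∈ Finset.HasAntidiagonal.antidiagonal b.natPred, coeff p.1 G *
        ((-1) ^ a.natPred * ((p.2 + a.natPred).choose a.natPred) *
          coeff (p.2 + a.natPred) (letterSeries F l)) =
      (-1) ^ b.natPred * -∑ x ∈ Finset.HasAntidiagonal.antidiagonal b.natPred,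
        (-1) ^ x.1 * coeff x.1 G * (((a.natPred + x.2).choose a.natPred : ℕ) *
          coeff (a.natPred + x.2) (letterSeries F l)) := by
    rw [← Finset.sum_neg_distrib, Finset.mul_sum]
    refine Finset.sum_congr rfl fun p hp => ?_
    rw [coeff_letterSeries, coeff_letterSeries, add_comm a.natPred]
    split_ifs with hdvd
    · have hp' := Finset.HasAntidiagonal.mem_antidiagonal.mp hp
      have h2 := neg_one_pow_of_dvd F (A := K) hdvd
      have h3 : (-1 : K) ^ p.1 * (-1) ^ p.1 = 1 := by rw [← mul_pow]; simp
      have h4 : (-1 : K) ^ a.natPred * (-1) ^ a.natPred = 1 := by rw [← mul_pow]; simp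
      rw [pow_succ, pow_add] at h2
      rw [← hp', pow_add]
      generalize ((p.2 + a.natPred).choose a.natPred : K) = c
      generalize evalWord l ([((p.2 + a.natPred).succPNat, 1)] : Word F) = v
      linear_combination (coeff p.1 G * c * v * (-1) ^ p.2) * h3
        - (coeff p.1 G * c * v * (-1) ^ a.natPred) * h2 - (coeff p.1 G * c * v * (-1) ^ p.2) * h4
    · simp
  have h2 : ∑ p ∈ Finset.HasAntidiagonal.antidiagonal a.natPred, coeff p.1 G *
        ((-1) ^ b.natPred * ((p.2 + b.natPred).choose b.natPred) *
          coeff (p.2 + b.natPred) (letterSeries F l)) =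
      (-1) ^ b.natPred * ∑ x ∈ Finset.HasAntidiagonal.antidiagonal a.natPred, coeff x.1 G *
        (((x.2 + b.natPred).choose x.2 : ℕ) * coeff (x.2 + b.natPred) (letterSeries F l)) := by
    rw [Finset.mul_sum]
    refine Finset.sum_congr rfl fun p hp => ?_
    rw [Nat.choose_symm_add]
    ring
  rw [h1, h2]
  have hab : (a + b).natPred = a.natPred + b.natPred + 1 := by
    have := a.natPred_add_one
    have := b.natPred_add_one
    have := (a + b).natPred_add_one
    simp only [PNat.add_coe] at *
    omega
  simp only [letterValue, hab]
  change z * coeff a.natPred G * (z * coeff b.natPred G) =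
    z * coeff (a.natPred + b.natPred + 1) G + _
  linear_combination z * (-1) ^ b.natPred * h +
    (z * coeff (a.natPred + b.natPred + 1) G - z ^ 2 * coeff a.natPred G * coeff b.natPred G) * hB

end LetterProduct

/-! ### Evaluation is multiplicative for the shuffle product -/

section Multiplicativity

variable {F K : Type*} [Field F] [Field K] [Algebra F K]

theorem eval_shuffle_of_ofWord (l : List (K × ℕ))
    (h : ∀ u v : Word F, eval l (shuffle (ofWord u) (ofWord v)) =
      eval l (ofWord u) * eval l (ofWord v)) (f g : WordSpace F) :
    eval l (shuffle f g) = eval l f * eval l g := by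
  have h1 : shuffle.compr₂ (eval l) = (LinearMap.mul F K).compl₁₂ (eval l) (eval l) :=
    wordSpace_ext fun u => wordSpace_ext fun v => h u v
  exact LinearMap.congr_fun₂ h1 f g

/-- By induction on the tower. The three terms of the shuffle recursion record whether the top step
is used by the first word, by the second, or by both; the last case is `letterValue_mul`. No
associativity of the shuffle product is needed. -/
theorem eval_shuffle [Finite F] (l : List (K × ℕ)) (f g : WordSpace F) :
    eval l (shuffle f g) = eval l f * eval l g := by
  induction l generalizing f g with
  | nil =>
    refine eval_shuffle_of_ofWord _ (fun u v => ?_) f g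
    rcases u with _ | ⟨⟨a, α⟩, u⟩
    · simp [shuffle_nil_left, eval_ofWord, evalWord]
    rcases v with _ | ⟨⟨b, β⟩, v⟩
    · simp [shuffle_nil_right, eval_ofWord, evalWord]
    · simp [shuffle_cons_cons, diamond_cons_cons, eval_nil_prepend, eval_ofWord, evalWord]
  | cons s l ih =>
    refine eval_shuffle_of_ofWord _ (fun u v => ?_) f g
    rcases u with _ | ⟨⟨a, α⟩, u⟩
    · simp [shuffle_nil_left, eval_ofWord, evalWord]
    rcases v with _ | ⟨⟨b, β⟩, v⟩
    · simp [shuffle_nil_right, eval_ofWord, evalWord]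
    have h1 := ih (ofWord ((a, α) :: u)) (ofWord ((b, β) :: v))
    have h2 := letterValue_mul (F := F) s.1 l a b
    rw [shuffle_cons_cons, diamond_cons_cons] at h1 ⊢
    simp only [map_add, map_sum, map_smul, eval_cons_prepend, smul_add, Finset.sum_add_distrib,
      ih, eval_ofWord, evalWord] at h1 ⊢
    have h3 : ∑ p ∈ pairs (a + b), delta F p.2 a b • (algebraMap F K (((α * β : Fˣ) : F) ^ s.2) *
          letterValue F s.1 l p.1 * (evalWord l ([(p.2, 1)] : Word F) *
            (evalWord l u * evalWord l v))) =
        algebraMap F K (((α * β : Fˣ) : F) ^ s.2) * (evalWord l u * evalWord l v) *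
          ∑ p ∈ pairs (a + b), algebraMap F K (delta F p.2 a b) * letterValue F s.1 l p.1 *
            evalWord l ([(p.2, 1)] : Word F) := by
      rw [Finset.mul_sum]
      refine Finset.sum_congr rfl fun p _ => ?_
      rw [Algebra.smul_def]
      ring
    rw [h3]
    simp only [Units.val_mul, mul_pow, map_mul]
    linear_combination h1 - algebraMap F K ((α : F) ^ s.2) * algebraMap F K ((β : F) ^ s.2) *
      (evalWord l u * evalWord l v) * h2

end Multiplicativity

/-! ### Generating series of sums over words -/

section WordSums

variable {K : Type*} [Field K]

/-- The words over `Σ` of weight `n`. -/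
noncomputable def wordsOfWeight (n : ℕ) : Finset (List ℕ+) := (finite_weight_eq n).toFinset

theorem mem_wordsOfWeight {n : ℕ} {a : List ℕ+} : a ∈ wordsOfWeight n ↔ weight a = n := by
  simp [wordsOfWeight]

theorem weight_cons (i : ℕ+) (a : List ℕ+) : weight (i :: a) = i + weight a := by
  simp [weight]

/-- The series `∑ c (depth a) g(a) T ^ weight a`, where `g` is extended multiplicatively. -/
noncomputable def wordSeries (g : ℕ+ → K) (c : ℕ → K) : K⟦X⟧ :=
  PowerSeries.mk fun n => ∑ a ∈ wordsOfWeight n, c a.length * (a.map g).prod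

theorem wordSeries_add (g : ℕ+ → K) (c d : ℕ → K) :
    wordSeries g (fun m => c m + d m) = wordSeries g c + wordSeries g d := by
  ext n
  simp [wordSeries, add_mul, Finset.sum_add_distrib]

/-- Splits off the first letter of each nonempty word. -/
theorem wordSeries_eq (g : ℕ+ → K) (c : ℕ → K) :
    wordSeries g c = C (c 0) +
      X * (PowerSeries.mk (fun n => g n.succPNat) * wordSeries g fun m => c (m + 1)) := by
  ext n
  rcases n with _ | n
  · have : wordsOfWeight 0 = {[]} := by
      ext a
      rw [mem_wordsOfWeight, Finset.mem_singleton]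
      rcases a with _ | ⟨i, a⟩
      · simp [weight]
      · simp [weight_cons]
    simp [wordSeries, this]
  · rw [map_add, coeff_succ_X_mul, coeff_mul, coeff_C, if_neg n.succ_ne_zero, zero_add]
    simp only [wordSeries, coeff_mk, Finset.mul_sum]
    rw [Finset.sum_sigma']
    symm
    refine Finset.sum_nbij (fun p => p.1.1.succPNat :: p.2) ?_ ?_ ?_ ?_
    · rintro ⟨⟨i, j⟩, a⟩ h
      simp only [Finset.mem_sigma, Finset.HasAntidiagonal.mem_antidiagonal, mem_wordsOfWeight,
        weight_cons, Nat.succPNat_coe] at h ⊢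
      omega
    · rintro ⟨⟨i, j⟩, a⟩ h ⟨⟨i', j'⟩, a'⟩ h' heq
      simp only [Finset.mem_coe, Finset.mem_sigma, Finset.HasAntidiagonal.mem_antidiagonal,
        List.cons.injEq] at h h' heq
      obtain ⟨h1, rfl⟩ := heq
      have := Nat.succPNat_injective h1
      obtain rfl : i = i' := this
      obtain rfl : j = j' := by omega
      rfl
    · intro a h
      rw [Finset.mem_coe, mem_wordsOfWeight] at h
      rcases a with _ | ⟨i, a⟩
      · simp [weight] at h
      · refine ⟨⟨(i.natPred, weight a), a⟩, ?_, ?_⟩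
        · have := i.natPred_add_one
          simp only [weight_cons, Finset.mem_coe, Finset.mem_sigma,
            Finset.HasAntidiagonal.mem_antidiagonal, mem_wordsOfWeight, and_true] at h ⊢
          omega
        · simp
    · rintro ⟨⟨i, j⟩, a⟩ h
      simp
      ring

/-- The coefficient of `T ^ m` in `(1 - T) ^ (-N)`. -/
noncomputable def multichooseCoeff (K : Type*) [Field K] (N m : ℕ) : K :=
  ((Ring.choose ((N : ℤ) + m - 1) m : ℤ) : K)

theorem multichooseCoeff_zero_right (N : ℕ) : multichooseCoeff K N 0 = 1 := by
  simp [multichooseCoeff]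

theorem multichooseCoeff_zero_succ (m : ℕ) : multichooseCoeff K 0 (m + 1) = 0 := by
  have h : ((0 : ℕ) : ℤ) + (m + 1 : ℕ) - 1 = (m : ℕ) := by push_cast; ring
  rw [multichooseCoeff, h, Ring.choose_natCast, Nat.choose_succ_self]
  simp

theorem multichooseCoeff_succ_succ (N m : ℕ) : multichooseCoeff K (N + 1) (m + 1) =
    multichooseCoeff K N (m + 1) + multichooseCoeff K (N + 1) m := by
  have h1 : ((N + 1 : ℕ) : ℤ) + (m + 1 : ℕ) - 1 = (N + m + 1 : ℕ) := by push_cast; ring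
  have h2 : ((N : ℕ) : ℤ) + (m + 1 : ℕ) - 1 = (N + m : ℕ) := by push_cast; ring
  have h3 : ((N + 1 : ℕ) : ℤ) + (m : ℕ) - 1 = (N + m : ℕ) := by push_cast; ring
  simp only [multichooseCoeff, h1, h2, h3, Ring.choose_natCast]
  rw [Nat.choose_succ_succ]
  push_cast
  ring

/-- By Pascal's rule and `wordSeries_eq`, passing from `N` to `N + 1` divides the word series by `1
+ X * ∑ g(x_{n+1}) X ^ n`. -/
theorem one_add_pow_mul_wordSeries (g : ℕ+ → K) (N : ℕ) :
    (1 + X * PowerSeries.mk fun n => g n.succPNat) ^ N *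
      wordSeries (fun i => -g i) (multichooseCoeff K N) = 1 := by
  have hneg : (PowerSeries.mk fun n => -g n.succPNat) = -PowerSeries.mk fun n => g n.succPNat := by
    ext n; simp
  induction N with
  | zero =>
    rw [wordSeries_eq]
    have : (wordSeries (fun i => -g i) fun m => multichooseCoeff K 0 (m + 1)) = 0 := by
      ext n
      simp [wordSeries, multichooseCoeff_zero_succ]
    simp [this, multichooseCoeff_zero_right]
  | succ N ih =>
    have h1 := wordSeries_eq (fun i => -g i) (multichooseCoeff K (N + 1))
    have h2 := wordSeries_eq (fun i => -g i) (multichooseCoeff K N)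
    simp only [multichooseCoeff_succ_succ, wordSeries_add, multichooseCoeff_zero_right, hneg,
      map_one] at h1 h2
    rw [pow_succ]
    linear_combination (1 + X * PowerSeries.mk fun n => g n.succPNat) ^ N * (h1 - h2) + ih

end WordSums

/-! ### Values of brackets and powers of the tower series -/

section Bracket

variable {F K : Type*} [Field F] [Finite F] [Field K] [Algebra F K]

/-- A letter of a word has index at most the weight `w`, so the term `binom (i - 1) w` vanishes and
`binom (i - 1) 0 = 1` remains. -/
theorem delta_one_succ_weight {F : Type*} [Field F] {i : ℕ+} {a : List ℕ+} (h : i ∈ a) :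
    delta F i 1 (weight a).succPNat = if Nat.card F - 1 ∣ (i : ℕ) then 1 else 0 := by
  have hle : (i : ℕ) ≤ weight a := List.single_le_sum (by simp) _ (List.mem_map_of_mem h)
  have h0 : ((i : ℕ) - 1).choose (weight a) = 0 :=
    Nat.choose_eq_zero_of_lt (by have := i.pos; omega)
  simp [delta, h0]

theorem eval_iteratedShuffle (l : List (K × ℕ)) (a : List ℕ+) :
    eval l (iteratedShuffle a : WordSpace F) =
      (a.map fun i => evalWord l ([(i, 1)] : Word F)).prod := by
  induction a with
  | nil => simp [iteratedShuffle, eval_ofWord, evalWord_nil]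
  | cons i a ih =>
    rw [List.map_cons, List.prod_cons, ← ih, ← eval_ofWord, ← eval_shuffle]
    rfl

theorem eval_bracket (l : List (K × ℕ)) (a : List ℕ+) :
    eval l (bracket a : WordSpace F) =
      (a.map fun i => -coeff i.natPred (letterSeries F l)).prod := by
  have h1 : (a.map fun i => delta F i 1 (weight a).succPNat) =
      a.map fun i : ℕ+ => if Nat.card F - 1 ∣ (i : ℕ) then 1 else 0 :=
    List.map_congr_left fun i hi => delta_one_succ_weight hi
  rw [bracket, h1, map_smul, eval_iteratedShuffle, Algebra.smul_def]
  clear h1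
  induction a with
  | nil => simp
  | cons i a ih =>
    simp only [List.map_cons, List.prod_cons, List.length_cons]
    rw [← ih, coeff_letterSeries, PNat.natPred_add_one, PNat.succPNat_natPred]
    split_ifs
    · simp only [map_mul, map_pow, map_neg, map_one, pow_succ]
      ring
    · simp

/-- Both sides are coefficients of `(e / T) ^ N = (1 + T L) ^ (-N)`. -/
theorem sum_eval_bracket (l : List (K × ℕ)) (N n : ℕ) :
    ∑ a ∈ wordsOfWeight n, multichooseCoeff K N a.length * eval l (bracket a : WordSpace F) =
      coeff (n + N) (towerSeries F l ^ N) := by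
  have hL : (PowerSeries.mk fun n => coeff n.succPNat.natPred (letterSeries F l)) =
      letterSeries F l := by
    ext n; simp
  have h1 := one_add_pow_mul_wordSeries (fun i => coeff i.natPred (letterSeries F l)) N
  rw [hL] at h1
  have h2 : towerSeries F l ^ N = X ^ N * wordSeries
      (fun i => -coeff i.natPred (letterSeries F l)) (multichooseCoeff K N) := by
    have h3 := congr_arg (· ^ N) (one_add_letterSeries_mul (F := F) l)
    simp only [mul_pow] at h3
    linear_combination (-towerSeries F l ^ N) * h1 + wordSeries
      (fun i => -coeff i.natPred (letterSeries F l)) (multichooseCoeff K N) * h3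
  rw [h2, coeff_X_pow_mul, wordSeries, coeff_mk]
  simp only [eval_bracket]

end Bracket

/-! ### The coproduct as concatenation of towers -/

section Coproduct

variable {F K : Type*} [Field F] [Field K] [Algebra F K]

theorem sum_index {M : Type*} [AddCommMonoid M] (n : ℕ+) (g : ℕ+ × List ℕ+ → M) :
    ∑ p ∈ index n, g p = ∑ m ∈ Finset.range n, ∑ a ∈ wordsOfWeight (n - (m + 1)),
      g (m.succPNat, a) := by
  rw [Finset.sum_sigma']
  symm
  refine Finset.sum_nbij' (fun p => (p.1.succPNat, p.2)) (fun p => ⟨p.1.natPred, p.2⟩)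
    ?_ ?_ ?_ ?_ ?_
  · rintro ⟨m, a⟩ h
    simp only [Finset.mem_sigma, Finset.mem_range, mem_wordsOfWeight, mem_index,
      Nat.succPNat_coe] at h ⊢
    omega
  · rintro ⟨m, a⟩ h
    have := m.natPred_add_one
    simp only [Finset.mem_sigma, Finset.mem_range, mem_wordsOfWeight, mem_index] at h ⊢
    omega
  · rintro ⟨m, a⟩ _; simp
  · rintro ⟨m, a⟩ _; simp
  · rintro ⟨m, a⟩ _; rfl

theorem algebraMap_coproductCoeff (m : ℕ) (a : List ℕ+) :
    algebraMap F K (coproductCoeff F m.succPNat a) = multichooseCoeff K m a.length := by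
  have h : ((m.succPNat : ℕ) : ℤ) + a.length - 2 = m + a.length - 1 := by
    rw [Nat.succPNat_coe]
    push_cast
    ring
  rw [coproductCoeff, multichooseCoeff, map_intCast, h]

/-- The index `r` of the left letter is `m + 1`, where `m` is the exponent of the inner series in
the expansion of `z / (1 - z e'(e(T)))`. -/
theorem letterValue_append [Finite F] (z : K) (l' l : List (K × ℕ)) (n : ℕ+) :
    letterValue F z (l' ++ l) n = ∑ p ∈ index n, algebraMap F K (coproductCoeff F p.1 p.2) *
      letterValue F z l' p.1 * eval l (bracket p.2 : WordSpace F) := by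
  rw [letterValue, towerSeries_append, coeff_geomSeries_subst z (constantCoeff_towerSeries F l')
    (constantCoeff_towerSeries F l), sum_index, PNat.natPred_add_one, Finset.mul_sum]
  refine Finset.sum_congr rfl fun m hm => ?_
  have h := sum_eval_bracket (F := F) l m (n - (m + 1))
  have hm' := Finset.mem_range.mp hm
  rw [show (n : ℕ) - (m + 1) + m = n.natPred by rw [PNat.natPred]; omega] at h
  rw [← h, Finset.mul_sum, Finset.mul_sum]
  refine Finset.sum_congr rfl fun a _ => ?_
  rw [algebraMap_coproductCoeff, letterValue, Nat.natPred_succPNat]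
  ring

/-- The value of a tensor on a pair of towers. -/
noncomputable def evalTensor (l' l : List (K × ℕ)) : WordSpace F ⊗[F] WordSpace F →ₗ[F] K :=
  LinearMap.mul' F K ∘ₗ TensorProduct.map (eval l') (eval l)

theorem evalTensor_tmul (l' l : List (K × ℕ)) (f g : WordSpace F) :
    evalTensor l' l (f ⊗ₜ[F] g) = eval l' f * eval l g := by
  simp [evalTensor]

theorem evalTensor_nil_map (l : List (K × ℕ)) (x : Letter F) (b : WordSpace F)
    (t : WordSpace F ⊗[F] WordSpace F) :
    evalTensor [] l (TensorProduct.map (prepend x) (shuffle b) t) = 0 := by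
  induction t with
  | zero => simp
  | tmul f g => simp [evalTensor_tmul, eval_nil_prepend]
  | add s t hs ht => simp only [map_add, hs, ht, add_zero]

theorem evalTensor_cons_map [Finite F] (s : K × ℕ) (l' l : List (K × ℕ)) (x : Letter F)
    (b : WordSpace F) (t : WordSpace F ⊗[F] WordSpace F) :
    evalTensor (s :: l') l (TensorProduct.map (prepend x) (shuffle b) t) =
      evalTensor l' l (TensorProduct.map (prepend x) (shuffle b) t) +
        algebraMap F K (x.2 ^ s.2) * letterValue F s.1 l' x.1 * eval l b *
          evalTensor l' l t := by
  induction t with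
  | zero => simp
  | tmul f g =>
    simp only [TensorProduct.map_tmul, evalTensor_tmul, eval_cons_prepend, eval_shuffle]
    ring
  | add s t hs ht => simp only [map_add, hs, ht]; ring

/-- On an empty upper tower only `1 ⊗ w` survives. Adding a step on top lets it take the first
letter, whose value is expanded by `letterValue_append`. -/
theorem evalTensor_coproductWord [Finite F] (l' l : List (K × ℕ)) (w : Word F) :
    evalTensor l' l (coproductWord w) = evalWord (l' ++ l) w := by
  induction w generalizing l' with
  | nil => simp [coproductWord, evalTensor_tmul, eval_ofWord, evalWord_nil]
  | cons x v ihw =>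
    induction l' with
    | nil =>
      simp [coproductWord, evalTensor_tmul, eval_ofWord, evalWord_nil, evalTensor_nil_map]
    | cons s l' ih =>
      rw [List.cons_append, evalWord, ← ih, ← ihw l', letterValue_append]
      simp only [coproductWord, map_add, map_sum, map_smul, evalTensor_tmul, eval_ofWord,
        evalWord_nil, evalTensor_cons_map, smul_add, Finset.sum_add_distrib]
      rw [add_assoc, Finset.mul_sum, Finset.sum_mul]
      congr 2
      refine Finset.sum_congr rfl fun p _ => ?_
      rw [Algebra.smul_def]
      ring

theorem evalTensor_coproduct [Finite F] (l' l : List (K × ℕ)) (f : WordSpace F) :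
    evalTensor l' l (coproduct f) = eval (l' ++ l) f := by
  have : evalTensor l' l ∘ₗ coproduct (F := F) = eval (l' ++ l) := by
    refine wordSpace_ext fun w => ?_
    have h : coproduct (ofWord w) = coproductWord w := by simp [coproduct, ofWord]
    rw [LinearMap.comp_apply, h, evalTensor_coproductWord, eval_ofWord]
  exact LinearMap.congr_fun this f

/-- The value of a triple tensor on a triple of towers. -/
noncomputable def evalTriple (l₁ l₂ l₃ : List (K × ℕ)) :
    WordSpace F ⊗[F] (WordSpace F ⊗[F] WordSpace F) →ₗ[F] K :=
  LinearMap.mul' F K ∘ₗ TensorProduct.map (eval l₁) (evalTensor l₂ l₃)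

theorem evalTriple_map_id_coproduct [Finite F] (l₁ l₂ l₃ : List (K × ℕ))
    (t : WordSpace F ⊗[F] WordSpace F) :
    evalTriple l₁ l₂ l₃ (TensorProduct.map LinearMap.id coproduct t) =
      evalTensor l₁ (l₂ ++ l₃) t := by
  induction t with
  | zero => simp
  | tmul f g => simp [evalTriple, evalTensor_tmul, evalTensor_coproduct]
  | add s t hs ht => simp only [map_add, hs, ht]

theorem evalTriple_assoc (l₁ l₂ l₃ : List (K × ℕ)) (t : WordSpace F ⊗[F] WordSpace F)
    (h : WordSpace F) :
    evalTriple l₁ l₂ l₃ (TensorProduct.assoc F _ _ _ (t ⊗ₜ[F] h)) =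
      evalTensor l₁ l₂ t * eval l₃ h := by
  induction t with
  | zero => simp
  | tmul f g => simp [evalTriple, evalTensor_tmul, mul_assoc]
  | add s t hs ht => simp only [TensorProduct.add_tmul, map_add, hs, ht, add_mul]

theorem evalTriple_map_coproduct_id [Finite F] (l₁ l₂ l₃ : List (K × ℕ))
    (t : WordSpace F ⊗[F] WordSpace F) :
    evalTriple l₁ l₂ l₃ (TensorProduct.assoc F _ _ _
      (TensorProduct.map coproduct LinearMap.id t)) = evalTensor (l₁ ++ l₂) l₃ t := by
  induction t with
  | zero => simp
  | tmul f g =>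
    rw [TensorProduct.map_tmul, evalTriple_assoc, evalTensor_tmul, evalTensor_coproduct]
    rfl
  | add s t hs ht => simp only [map_add, hs, ht]

end Coproduct

/-! ### Evaluations separate tensors -/

section Separation

variable {K : Type*} [Field K]

/-- A family of functions separates the finitely supported functions with values in `K`. -/
def Separating {A I : Type*} (φ : I → A → K) : Prop :=
  ∀ c : A →₀ K, (∀ i, Finsupp.linearCombination K (φ i) c = 0) → c = 0

theorem Separating.prod {A B I J : Type*} {φ : I → A → K} {ψ : J → B → K} (hφ : Separating φ)
    (hψ : Separating ψ) :
    Separating fun (ij : I × J) (ab : A × B) => φ ij.1 ab.1 * ψ ij.2 ab.2 := by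
  intro c hc
  -- Contracting the second variable against `ψ j` leaves a function on `A` killed by every `φ i`.
  have hd (j : J) :
      Finsupp.linearCombination K (fun ab : A × B => Finsupp.single ab.1 (ψ j ab.2)) c = 0 := by
    refine hφ _ fun i => ?_
    rw [← hc (i, j)]
    have : Finsupp.linearCombination K (φ i) ∘ₗ
        Finsupp.linearCombination K (fun ab : A × B => Finsupp.single ab.1 (ψ j ab.2)) =
        Finsupp.linearCombination K fun ab : A × B => φ i ab.1 * ψ j ab.2 := by
      ext ab
      simp [mul_comm]
    exact LinearMap.congr_fun this c
  have hcurry (a : A) : c.curry a = 0 := by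
    refine hψ _ fun j => ?_
    have h := DFunLike.congr_fun (hd j) a
    have : Finsupp.linearCombination K (ψ j) ∘ₗ Finsupp.lapply a ∘ₗ
        (Finsupp.curryLinearEquiv K).toLinearMap =
        Finsupp.lapply a ∘ₗ
          Finsupp.linearCombination K (fun ab : A × B => Finsupp.single ab.1 (ψ j ab.2)) := by
      classical
      ext ⟨a', b'⟩
      by_cases haa : a' = a
      · subst haa; simp [Finsupp.curry_single]
      · simp [Finsupp.curry_single, haa]
    exact (LinearMap.congr_fun this c).trans h
  ext ⟨a, b⟩
  simpa using DFunLike.congr_fun (hcurry a) b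

variable {F : Type*} [Field F] [Finite F] [Algebra F K]

/-- The tower series has leading term `T`; this makes the letter polynomials have exact degree. -/
theorem coeff_self_towerSeries_pow (l : List (K × ℕ)) (i : ℕ) :
    coeff i (towerSeries F l ^ i) = 1 := by
  obtain ⟨g, hg⟩ := X_dvd_iff.mpr (constantCoeff_towerSeries F l)
  have h1 := one_add_letterSeries_mul (F := F) l
  have h2 : (1 + X * letterSeries F l) * g = 1 := by
    refine mul_left_cancel₀ (X_ne_zero (R := K)) ?_
    rw [hg] at h1
    linear_combination h1
  have h3 := congr_arg constantCoeff h2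
  simp only [map_mul, map_add, map_one, constantCoeff_X, zero_mul, add_zero, one_mul] at h3
  have h4 := coeff_X_pow_mul (g ^ i) i 0
  rw [zero_add] at h4
  rw [hg, mul_pow, h4, coeff_zero_eq_constantCoeff_apply, map_pow, h3, one_pow]

/-- The value of the letter `x_{n,1}` as a polynomial in the new step of the tower. -/
noncomputable def letterPolynomial (F : Type*) [Field F] (l : List (K × ℕ)) : ℕ → Polynomial K
  | 0 => 1
  | i + 1 => Polynomial.X * ∑ m ∈ Finset.range (i + 1),
      Polynomial.C (coeff i (towerSeries F l ^ m)) * Polynomial.X ^ m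

theorem degree_letterPolynomial (l : List (K × ℕ)) (i : ℕ) :
    (letterPolynomial F l i).degree = i := by
  cases i with
  | zero => simp [letterPolynomial]
  | succ i =>
    have h : (∑ m ∈ Finset.range i, Polynomial.C (coeff i (towerSeries F l ^ m)) *
        Polynomial.X ^ m).degree < (i : WithBot ℕ) := by
      refine (Polynomial.degree_sum_le _ _).trans_lt
        ((Finset.sup_lt_iff (WithBot.bot_lt_coe i)).mpr fun m hm => ?_)
      exact (Polynomial.degree_C_mul_X_pow_le _ _).trans_lt
        (WithBot.coe_lt_coe.mpr (Finset.mem_range.mp hm))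
    simp only [letterPolynomial]
    rw [Finset.sum_range_succ, coeff_self_towerSeries_pow, map_one, one_mul,
      Polynomial.degree_mul, Polynomial.degree_X, Polynomial.degree_add_eq_right_of_degree_lt
        (by rwa [Polynomial.degree_X_pow]), Polynomial.degree_X_pow]
    push_cast
    ring

theorem eval_letterPolynomial {F : Type*} [Field F] [Finite F] (z : K) (l : List (K × ℕ)) (n : ℕ+) :
    (letterPolynomial F l n).eval z = letterValue F z l n := by
  rw [letterValue, coeff_geomSeries z (constantCoeff_towerSeries F l)]
  conv_lhs => rw [← n.natPred_add_one]
  simp only [letterPolynomial, Polynomial.eval_mul, Polynomial.eval_X, Polynomial.eval_finsetSum,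
    Polynomial.eval_C, Polynomial.eval_pow]
  simp only [mul_comm]

theorem linearIndependent_letterPolynomial (l : List (K × ℕ)) :
    LinearIndependent K fun n : ℕ+ => letterPolynomial F l n :=
  (Polynomial.Sequence.linearIndependent
    ⟨letterPolynomial F l, degree_letterPolynomial l⟩).comp _ PNat.coe_injective

/-- Varying `z` separates the indices `n`, since the values are polynomials of distinct degrees in
`z`; varying `k` separates the `ε`, by a Vandermonde argument. The exponents `k` in a tower serve
only this purpose. -/
theorem separating_letterValue [Infinite K] (l : List (K × ℕ)) :
    Separating fun (s : K × ℕ) (x : Letter F) =>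
      algebraMap F K (x.2 ^ s.2) * letterValue F s.1 l x.1 := by
  intro d hd
  have h1 (k : ℕ) : Finsupp.linearCombination K
      (fun x : Letter F => Finsupp.single x.1 (algebraMap F K (x.2 ^ k))) d = 0 := by
    refine linearIndependent_iff.mp (linearIndependent_letterPolynomial (F := F) l) _ ?_
    refine Polynomial.funext fun z => ?_
    rw [Polynomial.eval_zero, ← hd (z, k)]
    have : Polynomial.leval z ∘ₗ Finsupp.linearCombination K
          (fun n : ℕ+ => letterPolynomial F l n) ∘ₗ Finsupp.linearCombination K
          (fun x : Letter F => Finsupp.single x.1 (algebraMap F K (x.2 ^ k))) =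
        Finsupp.linearCombination K
          fun x : Letter F => algebraMap F K (x.2 ^ k) * letterValue F z l x.1 := by
      ext x
      simp [eval_letterPolynomial]
    exact LinearMap.congr_fun this d
  have := Fintype.ofFinite Fˣ
  have h2 (n : ℕ+) (k : ℕ) : ∑ ε : Fˣ, algebraMap F K ε ^ k * d (n, ε) = 0 := by
    have h := DFunLike.congr_fun (h1 k) n
    refine Eq.trans ?_ h
    have : (∑ ε : Fˣ, (algebraMap F K ε ^ k) • Finsupp.lapply (n, ε)) =
        Finsupp.lapply n ∘ₗ Finsupp.linearCombination K
          (fun x : Letter F => Finsupp.single x.1 (algebraMap F K (x.2 ^ k))) := by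
      classical
      ext ⟨m, η⟩
      by_cases hmn : m = n
      · subst hmn
        simp [Finsupp.single_apply, Finset.sum_ite_eq]
      · simp [hmn]
    simpa using LinearMap.congr_fun this d
  ext ⟨n, ε⟩
  have hv := Matrix.eq_zero_of_forall_pow_sum_mul_pow_eq_zero
    (f := fun i => algebraMap F K ((Fintype.equivFin Fˣ).symm i : Fˣ))
    (v := fun i => d (n, (Fintype.equivFin Fˣ).symm i)) ?_ ?_
  · simpa using congr_fun hv (Fintype.equivFin Fˣ ε)
  · exact (algebraMap F K).injective.comp
      (Units.val_injective.comp (Fintype.equivFin Fˣ).symm.injective)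
  · intro k
    rw [← h2 n k]
    simp only [mul_comm (d _)]
    exact Equiv.sum_comp (Fintype.equivFin Fˣ).symm fun ε => algebraMap F K ε ^ (k : ℕ) * d (n, ε)

/-- The difference of the values on `s :: l` and on `l` isolates the first letter at step `s`.
Separating letters reduces to the tails of the words beginning with a given letter. -/
theorem separating_evalWord [Infinite K] :
    Separating fun (l : List (K × ℕ)) (w : Word F) => evalWord l w := by
  intro c hc
  ext w
  induction w generalizing c with
  | nil =>
    rw [Finsupp.coe_zero, Pi.zero_apply, ← hc []]
    have : Finsupp.lapply ([] : Word F) =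
        Finsupp.linearCombination K (evalWord ([] : List (K × ℕ))) := by
      ext w
      cases w <;> simp [evalWord]
    exact LinearMap.congr_fun this c
  | cons x u ih =>
    have h := ih (Finsupp.lcomapDomain (R := K) (List.cons x) (List.cons_injective) c) fun l => ?_
    · exact h
    -- `D` sorts words by their first letter and evaluates the remainder on `l`.
    let D : (Word F →₀ K) →ₗ[K] Letter F →₀ K := Finsupp.linearCombination K fun w =>
      match w with
      | [] => 0
      | y :: v => Finsupp.single y (evalWord l v)
    have hD : D c = 0 := by
      refine separating_letterValue l _ fun s => ?_
      have : Finsupp.linearCombination K (evalWord (s :: l)) =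
          Finsupp.linearCombination K (evalWord l) + Finsupp.linearCombination K
            (fun y : Letter F => algebraMap F K (y.2 ^ s.2) * letterValue F s.1 l y.1) ∘ₗ D := by
        ext w
        rcases w with _ | ⟨y, v⟩
        · simp [D, evalWord, evalWord_nil]
        · simp [D, evalWord]; ring
      have h1 := LinearMap.congr_fun this c
      rw [LinearMap.add_apply, hc, hc, zero_add] at h1
      exact h1.symm
    have : Finsupp.linearCombination K (evalWord l) ∘ₗ
        Finsupp.lcomapDomain (R := K) (List.cons x) (List.cons_injective) =
        Finsupp.lapply x ∘ₗ D := by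
      classical
      ext w
      rcases w with _ | ⟨y, v⟩
      · simp [D, Finsupp.lcomapDomain, Finsupp.comapDomain_single_of_not_mem_range]
      · by_cases hyx : y = x
        · subst hyx
          simp [D, Finsupp.lcomapDomain]
        · have h0 : y :: v ∉ Set.range (List.cons x) := by
            rintro ⟨w, hw⟩
            exact hyx (List.cons.inj hw).1.symm
          simp [D, Finsupp.lcomapDomain, hyx,
            Finsupp.comapDomain_single_of_not_mem_range h0]
    exact (LinearMap.congr_fun this c).trans (DFunLike.congr_fun hD x)

theorem eq_zero_of_evalTriple [Infinite K] (t : WordSpace F ⊗[F] (WordSpace F ⊗[F] WordSpace F))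
    (h : ∀ l₁ l₂ l₃ : List (K × ℕ), evalTriple l₁ l₂ l₃ t = 0) : t = 0 := by
  let e : WordSpace F ⊗[F] (WordSpace F ⊗[F] WordSpace F) ≃ₗ[F] (Word F × Word F × Word F →₀ F) :=
    TensorProduct.congr (LinearEquiv.refl F _) (finsuppTensorFinsupp' F (Word F) (Word F)) ≪≫ₗ
      finsuppTensorFinsupp' F (Word F) (Word F × Word F)
  have hsep := separating_evalWord (K := K) (F := F)
  -- Coefficients are extended to `K`, because separation holds for `K`-valued coefficients.
  have h0 : (e t).mapRange (algebraMap F K) (map_zero _) = 0 := by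
    refine hsep.prod (hsep.prod hsep) _ ?_
    rintro ⟨l₁, l₂, l₃⟩
    rw [Finsupp.linearCombination_apply, Finsupp.sum_mapRange_index (by simp), ← h l₁ l₂ l₃]
    have : Finsupp.linearCombination F (fun w : Word F × Word F × Word F =>
        evalWord l₁ w.1 * (evalWord l₂ w.2.1 * evalWord l₃ w.2.2)) ∘ₗ e.toLinearMap =
        evalTriple l₁ l₂ l₃ := by
      ext u v w
      simp [e, evalTriple, evalTensor, eval]
    rw [← this]
    simp [Finsupp.linearCombination_apply, Algebra.smul_def]
  rw [← e.map_eq_zero_iff]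
  exact Finsupp.mapRange_injective _ (map_zero _) (algebraMap F K).injective
    (h0.trans (Finsupp.mapRange_zero).symm)

end Separation

end AMZV

theorem mainTheorem3 {F : Type*} [Field F] [Finite F] (u : AMZV.Word F) :
    TensorProduct.map LinearMap.id AMZV.coproduct (AMZV.coproduct (AMZV.ofWord u)) =
      TensorProduct.assoc F (AMZV.WordSpace F) (AMZV.WordSpace F) (AMZV.WordSpace F)
        (TensorProduct.map AMZV.coproduct LinearMap.id (AMZV.coproduct (AMZV.ofWord u))) := by
  -- The algebraic closure supplies an infinite extension of the finite field `F`.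
  refine sub_eq_zero.mp
    (AMZV.eq_zero_of_evalTriple (K := AlgebraicClosure F) _ fun l₁ l₂ l₃ => ?_)
  rw [map_sub, AMZV.evalTriple_map_id_coproduct, AMZV.evalTriple_map_coproduct_id,
    AMZV.evalTensor_coproduct, AMZV.evalTensor_coproduct, List.append_assoc, sub_self]
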